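/- Let $n>1$ and let $S=\mathbb N\times\{1,\dots,n\}$. Call a map $f:S\to S$ \emph{eventually a translation} if there are $z_1,\dots,z_n\in\mathbb N$ and $m_1,\dots,m_n\in\mathbb Z$ such that $f(i,x)=(i+m_x,x)$ for all $x\in\{1,\dots,n\}$ and all $i\ge z_x$. Let $H_n$ (Houghton's group) be the group of all permutations of $S$ that are eventually translations, and let $\mathcal M$ be the monoid of all injective maps $S\to S$ that are eventually translations. For $1\le y\le n$ let $t_y\in\mathcal M$ be the map with $t_y(i,y)=(i+1,y)$ and $t_y(i,x)=(i,x)$ for $x\ne y$, and let $T\subseteq\mathcal M$ be the submonoid generated by $t_1,\dots,t_n$. Order $\mathcal M$ by $\alpha\le\beta$ if and only if $\beta=\alpha\circ t$ (first $t$, then $\alpha$) for some $t\in T$; this is a partial order, and $H_n$ acts on the poset $\mathcal M$ by post-composition, $\alpha\mapsto h\circ\alpha$. Let $|\mathcal M|$ be the geometric realisation of this poset, whose $k$-simplices are the chains of $k+1$ elements of $\mathcal M$, with the weak topology and the induced action of $H_n$. Then $|\mathcal M|$ is a model for $\underline{\mathrm E}H_n$, the classifying space for proper actions of $H_n$. That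 is: $|\mathcal M|$, with its simplices as cells, is an $H_n$-CW-complex (a CW-complex with an action by homeomorphisms that permutes the cells and for which the setwise and the pointwise stabiliser of each cell coincide); the fixed set $|\mathcal M|^Q$ is contractible for every finite subgroup $Q\le H_n$; and $|\mathcal M|^Q=\emptyset$ for every infinite subgroup $Q\le H_n$. Moreover, the stabiliser in $H_n$ of every simplex of $|\mathcal M|$ is finite, and for every finite subgroup $Q\le H_n$ the fixed poset $\mathcal M^Q$ is non-empty and directed (any two elements have a common upper bound in $\mathcal M^Q$), so that $|\mathcal M|^Q$ is in particular non-empty. -/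

import Mathlib

open Set Topology
open scoped Pointwise

/-! ### The geometric realisation of a poset -/

/-- A point of the geometric realisation of a poset `P`, in barycentric coordinates: a finitely
supported function with nonnegative values, of total mass `1`, supported on a chain of `P`. -/
@[ext]
structure Realization (P : Type*) [PartialOrder P] where
  weight : P →₀ ℝ
  nonneg : ∀ p, 0 ≤ weight p
  total : (weight.sum fun _ r => r) = 1
  chain : IsChain (· ≤ ·) (weight.support : Set P)

namespace Realization

variable {P : Type*} [PartialOrder P]

/-- The closed geometric simplex spanned by a finite set `s` of vertices. -/
def simplex (s : Finset P) : Set (Realization P) := {x | x.weight.support ⊆ s}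

/-- The weak topology: each closed simplex (spanned by a finite chain) carries the Euclidean
topology given by its barycentric coordinates, and a set is open if and only if its intersection
with each closed simplex is open in that simplex. -/
instance : TopologicalSpace (Realization P) :=
  ⨆ s : {s : Finset P // IsChain (· ≤ ·) (s : Set P)},
    TopologicalSpace.coinduced (Subtype.val : simplex s.1 → Realization P)
      (TopologicalSpace.induced (fun (x : simplex s.1) (p : P) => x.1.weight p) inferInstance)

/-- The map of realisations that extends a monotone map affinely over each simplex. -/
noncomputable def map {Q : Type*} [PartialOrder Q] (f : P →o Q) (x : Realization P) :
    Realization Q where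
  weight := x.weight.mapDomain f
  nonneg q := by
    classical
    rw [Finsupp.mapDomain, Finsupp.sum_apply]
    refine Finset.sum_nonneg fun p _ => ?_
    change 0 ≤ Finsupp.single (f p) (x.weight p) q
    rw [Finsupp.single_apply]
    split_ifs
    · exact x.nonneg p
    · exact le_rfl
  total := by
    rw [Finsupp.sum_mapDomain_index (fun _ => rfl) (fun _ _ _ => rfl)]
    exact x.total
  chain := by
    classical
    have h : ((x.weight.mapDomain f).support : Set Q) ⊆ f '' (x.weight.support : Set P) := by
      have h0 := Finsupp.mapDomain_support (f := f) (s := x.weight)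
      intro q hq
      have h1 := h0 (Finset.mem_coe.1 hq)
      simpa using h1
    refine IsChain.mono h ?_
    rintro _ ⟨a, ha, rfl⟩ _ ⟨b, hb, rfl⟩ _
    rcases x.chain.total ha hb with hab | hab
    · exact Or.inl (f.monotone hab)
    · exact Or.inr (f.monotone hab)

/-- A group acting on `P` by monotone maps acts on the realisation by simplicial maps. -/
noncomputable instance {G : Type*} [Group G] [MulAction G P]
    [CovariantClass G P HSMul.hSMul LE.le] : MulAction G (Realization P) where
  smul g x := map ⟨fun p => g • p, fun _ _ h => CovariantClass.elim g h⟩ x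
  one_smul x := by
    apply Realization.ext
    change x.weight.mapDomain (fun p => (1 : G) • p) = x.weight
    simp only [one_smul]
    exact Finsupp.mapDomain_id
  mul_smul g h x := by
    apply Realization.ext
    change x.weight.mapDomain (fun p => (g * h) • p) =
      (x.weight.mapDomain (fun p => h • p)).mapDomain (fun p => g • p)
    rw [← Finsupp.mapDomain_comp]
    congr 1
    funext p
    exact mul_smul g h p

end Realization

/-! ### Models for classifying spaces with respect to a family of subgroups -/

/-- `X`, with the given cell structure, is a `G`-CW-complex: a CW-complex with a cellular, rigid
action of `G` by homeomorphisms.  Cellular means that `G` permutes the cells, rigid that the setwise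
and the pointwise stabiliser of each (open) cell coincide. -/
structure IsGCWComplex (G : Type*) [Group G] {X : Type*} [TopologicalSpace X] [MulAction G X]
    (cw : CWComplex (univ : Set X)) : Prop where
  hausdorff : T2Space X
  continuous_smul : ∀ g : G, Continuous fun x : X => g • x
  cellular : ∀ (g : G) (k : ℕ) (i : RelCWComplex.cell (univ : Set X) k),
    ∃ j : RelCWComplex.cell (univ : Set X) k,
      g • RelCWComplex.openCell (C := (univ : Set X)) k i = RelCWComplex.openCell k j
  rigid : ∀ (k : ℕ) (i : RelCWComplex.cell (univ : Set X) k),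
    MulAction.stabilizer G (RelCWComplex.openCell (C := (univ : Set X)) k i) =
      fixingSubgroup G (RelCWComplex.openCell (C := (univ : Set X)) k i)

/-- `X` is a model for `E_F G`: a `G`-CW-complex such that `X^H` is contractible for each subgroup
`H` in the family `F` and empty for each subgroup `H` not in `F`. -/
structure IsModelForE (G : Type*) [Group G] (F : Set (Subgroup G)) {X : Type*}
    [TopologicalSpace X] [MulAction G X] (cw : CWComplex (univ : Set X)) : Prop
    extends IsGCWComplex G cw where
  contractible : ∀ H ∈ F, ContractibleSpace (MulAction.fixedPoints H X)
  empty : ∀ H ∉ F, MulAction.fixedPoints H X = ∅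

/-- The family of finite subgroups. -/
def finiteSubgroups (G : Type*) [Group G] : Set (Subgroup G) := {H | Finite H}

/-! ### Houghton's group and the poset of injective eventual translations -/

/-- The disjoint union of `n` rays, the point `(i, x)` being the `i`-th point on the ray `x`. -/
abbrev Rays (n : ℕ) : Type := ℕ × Fin n

/-- `f` is eventually a translation: on the ray `x` it is `(i, x) ↦ (i + m x, x)` for
all `i ≥ z x`. -/
def EventuallyTranslation {n : ℕ} (f : Rays n → Rays n) : Prop :=
  ∃ (z : Fin n → ℕ) (m : Fin n → ℤ), ∀ (x : Fin n) (i : ℕ), z x ≤ i →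
    (f (i, x)).2 = x ∧ ((f (i, x)).1 : ℤ) = (i : ℤ) + m x

theorem EventuallyTranslation.id {n : ℕ} : EventuallyTranslation (fun s : Rays n => s) :=
  ⟨fun _ => 0, fun _ => 0, fun _ _ _ => by simp⟩

theorem EventuallyTranslation.comp {n : ℕ} {f g : Rays n → Rays n}
    (hf : EventuallyTranslation f) (hg : EventuallyTranslation g) :
    EventuallyTranslation (fun s => f (g s)) := by
  obtain ⟨z, m, h⟩ := hf
  obtain ⟨z', m', h'⟩ := hg
  refine ⟨fun x => z' x + z x + (m' x).natAbs, fun x => m' x + m x, fun x i hi => ?_⟩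
  change z' x + z x + (m' x).natAbs ≤ i at hi
  obtain ⟨h1, h2⟩ := h' x i (by omega)
  have e : g (i, x) = ((g (i, x)).1, x) := Prod.ext rfl h1
  obtain ⟨h3, h4⟩ := h x (g (i, x)).1 (by omega)
  rw [← e] at h3 h4
  refine ⟨h3, ?_⟩
  change ((f (g (i, x))).1 : ℤ) = (i : ℤ) + (m' x + m x)
  omega

theorem EventuallyTranslation.symm {n : ℕ} {f : Equiv.Perm (Rays n)}
    (hf : EventuallyTranslation f) : EventuallyTranslation (f.symm) := by
  obtain ⟨z, m, h⟩ := hf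
  refine ⟨fun x => z x + (m x).natAbs, fun x => - m x, fun x i hi => ?_⟩
  change z x + (m x).natAbs ≤ i at hi
  obtain ⟨h1, h2⟩ := h x ((i : ℤ) - m x).toNat (by omega)
  have e : f (((i : ℤ) - m x).toNat, x) = (i, x) :=
    Prod.ext (by change (f (((i : ℤ) - m x).toNat, x)).1 = i; omega) h1
  rw [← e, Equiv.symm_apply_apply]
  refine ⟨rfl, ?_⟩
  change ((((i : ℤ) - m x).toNat : ℕ) : ℤ) = (i : ℤ) + - m x
  omega

/-- Houghton's group `H_n` of all permutations of `n` rays that are eventually translations. -/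
def HoughtonGroup (n : ℕ) : Subgroup (Equiv.Perm (Rays n)) where
  carrier := {h | EventuallyTranslation h}
  mul_mem' hf hg := EventuallyTranslation.comp hf hg
  one_mem' := EventuallyTranslation.id
  inv_mem' hf := EventuallyTranslation.symm hf

/-- Brown's monoid `M` of all injective maps from `n` rays to themselves that are eventually
translations. -/
@[ext]
structure BrownMap (n : ℕ) where
  toFun : Rays n → Rays n
  injective : Function.Injective toFun
  eventuallyTranslation : EventuallyTranslation toFun

namespace BrownMap

variable {n : ℕ}

instance : FunLike (BrownMap n) (Rays n) (Rays n) where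
  coe := toFun
  coe_injective _ _ h := BrownMap.ext h

/-- Multiplication is composition: `(α * β) s = α (β s)`. -/
instance : Monoid (BrownMap n) where
  mul α β := ⟨fun s => α (β s), α.injective.comp β.injective,
    α.eventuallyTranslation.comp β.eventuallyTranslation⟩
  one := ⟨fun s => s, Function.injective_id, EventuallyTranslation.id⟩
  mul_assoc _ _ _ := rfl
  one_mul _ := rfl
  mul_one _ := rfl

/-- The generating translation `t_y`, moving the ray `y` one step and fixing the other rays. -/
def shift (y : Fin n) : BrownMap n where
  toFun s := if s.2 = y then (s.1 + 1, s.2) else s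
  injective := by
    rintro ⟨i, x⟩ ⟨j, x'⟩ h
    by_cases h1 : x = y <;> by_cases h2 : x' = y <;> simp_all
  eventuallyTranslation := by
    refine ⟨fun _ => 0, fun x => if x = y then 1 else 0, fun x i _ => ?_⟩
    by_cases h1 : x = y <;> simp [h1]

/-- The monoid `T` of translations, generated by `t_1, …, t_n`. -/
def translations (n : ℕ) : Submonoid (BrownMap n) := Submonoid.closure (Set.range shift)

theorem exists_of_mem_translations {t : BrownMap n} (ht : t ∈ translations n) :
    ∃ k : Fin n → ℕ, ∀ s : Rays n, t s = (s.1 + k s.2, s.2) := by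
  induction ht using Submonoid.closure_induction with
  | mem t h =>
    obtain ⟨y, rfl⟩ := h
    refine ⟨fun x => if x = y then 1 else 0, fun s => ?_⟩
    change (if s.2 = y then (s.1 + 1, s.2) else s) = _
    by_cases h1 : s.2 = y <;> simp [h1]
  | one => exact ⟨fun _ => 0, fun s => rfl⟩
  | mul a b _ _ ha hb =>
    obtain ⟨k, hk⟩ := ha
    obtain ⟨l, hl⟩ := hb
    refine ⟨fun x => l x + k x, fun s => ?_⟩
    change a (b s) = _
    rw [hl, hk]
    simp [add_assoc]

/-- `α ≤ β` if and only if `β` is obtained from `α` by first applying some translation `t`. -/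
instance : PartialOrder (BrownMap n) where
  le α β := ∃ t ∈ translations n, ∀ s, β s = α (t s)
  le_refl α := ⟨1, one_mem _, fun _ => rfl⟩
  le_trans α β γ := by
    rintro ⟨t, ht, h⟩ ⟨u, hu, h'⟩
    exact ⟨t * u, mul_mem ht hu, fun s => by rw [h', h]; rfl⟩
  le_antisymm α β := by
    rintro ⟨t, ht, h⟩ ⟨u, hu, h'⟩
    obtain ⟨k, hk⟩ := exists_of_mem_translations ht
    obtain ⟨l, hl⟩ := exists_of_mem_translations hu
    have hs : ∀ s, t s = s := fun s => by
      have e : s = t (u s) := α.injective (by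
        have h1 := h' s
        rw [h] at h1
        exact h1)
      rw [hl, hk] at e
      have e1 : s.1 = s.1 + l s.2 + k s.2 := congrArg Prod.fst e
      rw [hk]
      exact Prod.ext (by simp only; omega) rfl
    exact DFunLike.ext _ _ fun s => by rw [h, hs]

/-- Houghton's group acts by composition: first `α`, then `h`. -/
instance : MulAction (HoughtonGroup n) (BrownMap n) where
  smul h α := ⟨fun s => h.1 (α s), h.1.injective.comp α.injective,
    EventuallyTranslation.comp h.2 α.eventuallyTranslation⟩
  one_smul _ := rfl
  mul_smul _ _ _ := rfl

instance : CovariantClass (HoughtonGroup n) (BrownMap n) HSMul.hSMul LE.le where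
  elim h α β := by
    rintro ⟨t, ht, e⟩
    exact ⟨t, ht, fun s => congrArg h.1 (e s)⟩

end BrownMap

/-! A group element acting monotonically that carries a finite chain into itself fixes each of its
elements. Hence the action on the realisation is rigid, and the fixed set of a subgroup `Q` consists
of the points supported on the fixed poset (`fixedPoints_eq_supportedIn`), which reduces the
statements on fixed sets to order theory in `BrownMap n`.

Two maps in the monoid agree on each ray after shifting the source, and the least such shifts give a
join (`exists_isLUB`). If `q ∘ α = α` then `q ∘ α ∘ t = α ∘ t`, so the fixed poset is an upper set,
and for any fixed `a` the comparisons `p ≤ p ∨ a ≥ a` contract its realisation to the vertex `a`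
(`contractibleSpace_supportedIn`). A permutation that fixes `α` is the identity on the cofinite
range of `α`, so stabilisers are finite (`finite_stabilizer`) and an infinite subgroup has no fixed
point. A finite subgroup fixes a sufficiently long translation, since elements of finite order are
eventually the identity (`exists_forall_apply_eq`).

The remaining work is topological: comparable monotone maps are homotopic through an explicit prism
that is continuous for the weak topology (`continuous_prism`), and the simplices are the cells of a
CW structure (`cwComplex`). -/

theorem Finsupp.mapDomain_apply_eq_sum_of_subset {P Q : Type*} [DecidableEq Q]
    (f : P → Q) {w : P →₀ ℝ} {s : Finset P}
    (hw : w.support ⊆ s) (q : Q) :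
    w.mapDomain f q = ∑ p ∈ s, if f p = q then w p else 0 := by
  rw [Finsupp.mapDomain, Finsupp.sum_apply, Finsupp.sum_of_support_subset _ hw]
  · simp only [Finsupp.single_apply]
  · simp

theorem Finsupp.exists_of_mem_support_mapDomain {P Q : Type*} {f : P → Q} {w : P →₀ ℝ} {q : Q}
    (h : q ∈ (w.mapDomain f).support) : ∃ p ∈ w.support, f p = q := by
  classical
  simpa using Finsupp.mapDomain_support h

/-! ### The weak topology: continuity into and out of a realisation. -/

namespace Realization

variable {P : Type*} [PartialOrder P]

theorem mem_simplex {s : Finset P} {x : Realization P} :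
    x ∈ simplex s ↔ x.weight.support ⊆ s := Iff.rfl

theorem weight_eq_zero {s : Finset P} {x : Realization P} (hx : x ∈ simplex s) {p : P}
    (hp : p ∉ s) : x.weight p = 0 := by
  by_contra h
  exact hp (hx (Finsupp.mem_support_iff.2 h))

theorem sum_weight {s : Finset P} {x : Realization P} (hx : x ∈ simplex s) :
    ∑ p ∈ s, x.weight p = 1 := by
  rw [← x.total, Finsupp.sum_of_support_subset _ hx _ (fun _ _ => rfl)]

theorem support_nonempty (x : Realization P) : x.weight.support.Nonempty := by
  by_contra h
  have h1 := sum_weight (mem_simplex.2 (Finset.Subset.refl x.weight.support))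
  rw [Finset.not_nonempty_iff_eq_empty.1 h] at h1
  simp at h1

/-- The weak topology refines the coordinatewise one. Since coordinates separate points, this gives
the Hausdorff property. -/
theorem continuous_weight (p : P) : Continuous fun x : Realization P => x.weight p := by
  refine continuous_iSup_dom.2 fun s => continuous_coinduced_dom.2 ?_
  let : TopologicalSpace (simplex s.1) :=
    TopologicalSpace.induced (fun x p => x.1.weight p) inferInstance
  exact (continuous_apply p).comp continuous_induced_dom

instance : T2Space (Realization P) := by
  refine ⟨fun x y hxy => ?_⟩
  obtain ⟨p, hp⟩ : ∃ p, x.weight p ≠ y.weight p := by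
    by_contra! h
    exact hxy (Realization.ext (Finsupp.ext h))
  exact separated_by_continuous (continuous_weight p) hp

/-- On a closed simplex the subspace topology is given by the barycentric coordinates. -/
theorem simplex_topology {s : Finset P} (hs : IsChain (· ≤ ·) (s : Set P)) :
    (instTopologicalSpaceSubtype : TopologicalSpace (simplex s)) =
      TopologicalSpace.induced (fun x p => x.1.weight p) inferInstance := by
  apply le_antisymm
  · rw [← continuous_iff_le_induced]
    exact continuous_pi fun p => (continuous_weight p).comp continuous_subtype_val
  · change _ ≤ TopologicalSpace.induced _ _
    rw [← continuous_iff_le_induced]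
    exact continuous_iSup_rng (i := ⟨s, hs⟩) continuous_coinduced_rng

theorem continuous_iff_continuousOn_simplex {Z : Type*} [TopologicalSpace Z]
    {F : Realization P → Z} :
    Continuous F ↔ ∀ s : Finset P, IsChain (· ≤ ·) (s : Set P) → ContinuousOn F (simplex s) := by
  refine ⟨fun h s _ => h.continuousOn, fun h => ?_⟩
  refine continuous_iSup_dom.2 fun s => continuous_coinduced_dom.2 ?_
  have h1 := continuousOn_iff_continuous_domRestrict.1 (h s.1 s.2)
  rw [← simplex_topology s.2]
  exact h1

/-- A set is closed if its intersection with each closed simplex is. -/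
theorem isClosed_of_inter_simplex {A : Set (Realization P)}
    (h : ∀ s : Finset P, IsChain (· ≤ ·) (s : Set P) → IsClosed (A ∩ simplex s)) :
    IsClosed A := by
  refine isClosed_iSup_iff.2 fun s => isClosed_coinduced.2 ?_
  rw [← simplex_topology s.2]
  have h1 := (h s.1 s.2).preimage (continuous_subtype_val (p := (· ∈ simplex s.1)))
  rwa [preimage_inter, Subtype.coe_preimage_self, inter_univ] at h1

theorem continuousOn_of_simplex {Z : Type*} [TopologicalSpace Z] {F : Z → Realization P}
    {A : Set Z} {t : Finset P} (ht : IsChain (· ≤ ·) (t : Set P))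
    (hF : ∀ z ∈ A, F z ∈ simplex t) (hc : ∀ p, ContinuousOn (fun z => (F z).weight p) A) :
    ContinuousOn F A := by
  rw [continuousOn_iff_continuous_domRestrict]
  have h : Continuous fun z : A => (⟨F z, hF z z.2⟩ : simplex t) := by
    rw [simplex_topology ht]
    exact continuous_induced_rng.2 (continuous_pi fun p => (hc p).domRestrict)
  exact continuous_subtype_val.comp h

/-- A map into the realisation whose values are supported in a fixed finite set is continuous as
soon as its barycentric coordinates are. -/
theorem continuous_of_weight {Z : Type*} [TopologicalSpace Z] {F : Z → Realization P}
    (u : Finset P) (hF : ∀ z, F z ∈ simplex u) (hc : ∀ p, Continuous fun z => (F z).weight p) :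
    Continuous F := by
  classical
  -- The set `u` need not be a chain, so there is no single simplex to land in. The finitely many
  -- chains `t ⊆ u` give a closed cover of the source, and `F` maps each piece into one simplex.
  let ι := {t : Finset P // t ⊆ u ∧ IsChain (· ≤ ·) (t : Set P)}
  have : Finite ι := Finite.of_injective
    (fun t : ι => (⟨t.1, Finset.mem_powerset.2 t.2.1⟩ : {t // t ∈ u.powerset}))
    fun a b h => Subtype.ext (congrArg (fun t => t.1) h)
  refine (locallyFinite_of_finite fun t : ι => {z | ∀ p ∉ t.1, (F z).weight p = 0}).continuous
    ?_ (fun t => ?_) fun t => ?_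
  · refine eq_univ_of_forall fun z => mem_iUnion.2 ⟨⟨_, hF z, (F z).chain⟩, fun p hp => ?_⟩
    exact Finsupp.notMem_support_iff.1 hp
  · simp only [ofPred_forall]
    exact isClosed_biInter fun p _ => isClosed_eq (hc p) continuous_const
  · refine continuousOn_of_simplex t.2.2 (fun z hz p hp => ?_) fun p => (hc p).continuousOn
    by_contra h
    exact Finsupp.mem_support_iff.1 hp (hz p h)

theorem map_mem_simplex {Q : Type*} [PartialOrder Q] [DecidableEq Q] (f : P →o Q) {s : Finset P}
    {x : Realization P} (hx : x ∈ simplex s) : map f x ∈ simplex (s.image f) :=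
  Finsupp.mapDomain_support.trans (Finset.image_subset_image hx)

theorem continuous_map {Q : Type*} [PartialOrder Q] (f : P →o Q) :
    Continuous (map f : Realization P → Realization Q) := by
  classical
  refine continuous_iff_continuousOn_simplex.2 fun s _ =>
    continuousOn_iff_continuous_domRestrict.2 ?_
  refine continuous_of_weight (s.image f) (fun x => map_mem_simplex f x.2) fun q => ?_
  have h : ∀ x : simplex s, (map f x.1).weight q = ∑ p ∈ s, if f p = q then x.1.weight p else 0 :=
    fun x => Finsupp.mapDomain_apply_eq_sum_of_subset f x.2 q
  simp only [domRestrict_apply, h]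
  refine continuous_finsetSum _ fun p _ => ?_
  split_ifs
  · exact (continuous_weight p).comp continuous_subtype_val
  · exact continuous_const

/-! ### Comparable monotone maps are homotopic -/

open scoped Classical in
/-- The mass of the vertices above `p`. -/
noncomputable def massAbove (x : Realization P) (p : P) : ℝ :=
  ∑ q ∈ x.weight.support with p < q, x.weight q

open scoped Classical in
theorem massAbove_eq_sum {s : Finset P} {x : Realization P} (hx : x ∈ simplex s) (p : P) :
    x.massAbove p = ∑ q ∈ s, if p < q then x.weight q else 0 := by
  rw [massAbove, Finset.sum_filter]
  refine Finset.sum_subset hx fun q _ hq => ?_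
  rw [Finsupp.notMem_support_iff.1 hq, ite_self]

/-- Stack the weights along the chain from the top, so that `p` occupies the interval from
`massAbove p` to `massAbove p + weight p`. These intervals do not overlap; `topMass` below is the
length of the part of each lying below height `t`. -/
theorem massAbove_add_le (x : Realization P) {p q : P} (h : p < q) :
    x.massAbove q + x.weight q ≤ x.massAbove p := by
  classical
  by_cases hq : q ∈ x.weight.support
  · have h1 : q ∉ {r ∈ x.weight.support | q < r} := by simp
    rw [massAbove, add_comm, ← Finset.sum_insert h1]
    refine Finset.sum_le_sum_of_subset_of_nonneg ?_ fun r _ _ => x.nonneg r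
    intro r hr
    rcases Finset.mem_insert.1 hr with rfl | hr
    · exact Finset.mem_filter.2 ⟨hq, h⟩
    · rw [Finset.mem_filter] at hr ⊢
      exact ⟨hr.1, h.trans hr.2⟩
  · rw [Finsupp.notMem_support_iff.1 hq, add_zero]
    refine Finset.sum_le_sum_of_subset_of_nonneg ?_ fun r _ _ => x.nonneg r
    exact Finset.monotone_filter_right _ fun r _ hr => h.trans hr

theorem massAbove_add_le_one (x : Realization P) (p : P) : x.massAbove p + x.weight p ≤ 1 := by
  classical
  rw [← sum_weight (mem_simplex.2 (Finset.Subset.refl x.weight.support))]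
  by_cases hp : p ∈ x.weight.support
  · have h1 : p ∉ {r ∈ x.weight.support | p < r} := by simp
    rw [massAbove, add_comm, ← Finset.sum_insert h1]
    refine Finset.sum_le_sum_of_subset_of_nonneg ?_ fun r _ _ => x.nonneg r
    exact Finset.insert_subset hp (Finset.filter_subset _ _)
  · rw [Finsupp.notMem_support_iff.1 hp, add_zero]
    exact Finset.sum_le_sum_of_subset_of_nonneg (Finset.filter_subset _ _) fun r _ _ => x.nonneg r

theorem massAbove_nonneg (x : Realization P) (p : P) : 0 ≤ x.massAbove p :=
  Finset.sum_nonneg fun r _ => x.nonneg r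

/-- The part of the mass of each vertex that belongs to the upper portion of total mass `t`. -/
noncomputable def topMass (x : Realization P) (t : ℝ) : P →₀ ℝ :=
  Finsupp.onFinset x.weight.support (fun p => min (x.weight p) (max 0 (t - x.massAbove p)))
    fun p hp => Finsupp.mem_support_iff.2 fun h =>
      hp (by rw [h]; exact min_eq_left (le_max_left _ _))

theorem topMass_apply (x : Realization P) (t : ℝ) (p : P) :
    x.topMass t p = min (x.weight p) (max 0 (t - x.massAbove p)) := rfl

theorem topMass_support (x : Realization P) (t : ℝ) :
    (x.topMass t).support ⊆ x.weight.support := Finsupp.support_onFinset_subset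

theorem sub_topMass_support (x : Realization P) (t : ℝ) :
    (x.weight - x.topMass t).support ⊆ x.weight.support := by
  classical
  exact Finsupp.support_sub.trans (Finset.union_subset (Finset.Subset.refl _) (topMass_support x t))

theorem topMass_nonneg (x : Realization P) (t : ℝ) (p : P) : 0 ≤ x.topMass t p :=
  le_min (x.nonneg p) (le_max_left _ _)

theorem topMass_le (x : Realization P) (t : ℝ) (p : P) : x.topMass t p ≤ x.weight p :=
  min_le_left _ _

theorem topMass_zero (x : Realization P) : x.topMass 0 = 0 := by
  ext p
  rw [topMass_apply, max_eq_left (by linarith [x.massAbove_nonneg p]), min_eq_right (x.nonneg p)]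
  rfl

theorem topMass_one (x : Realization P) : x.topMass 1 = x.weight := by
  ext p
  rw [topMass_apply, min_eq_left]
  exact (by linarith [x.massAbove_add_le_one p] : _ ≤ 1 - x.massAbove p).trans (le_max_right _ _)

/-- The prism homotopy between two comparable monotone maps: at time `t` the upper portion of mass
`t` is moved by `g`, the rest by `f`. -/
noncomputable def prism {Q : Type*} [PartialOrder Q] {f g : P →o Q} (hfg : ∀ p, f p ≤ g p)
    (t : ℝ) (x : Realization P) : Realization Q where
  weight := (x.weight - x.topMass t).mapDomain f + (x.topMass t).mapDomain g
  nonneg q := add_nonneg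
    (Finsupp.mapDomain_nonneg (f := f) (fun p => sub_nonneg.2 (x.topMass_le t p)) q)
    (Finsupp.mapDomain_nonneg (f := g) (x.topMass_nonneg t) q)
  total := by
    rw [Finsupp.sum_add_index' (fun _ => rfl) (fun _ _ _ => rfl),
      Finsupp.sum_mapDomain_index (fun _ => rfl) (fun _ _ _ => rfl),
      Finsupp.sum_mapDomain_index (fun _ => rfl) (fun _ _ _ => rfl),
      ← Finsupp.sum_add_index' (fun _ => rfl) (fun _ _ _ => rfl), sub_add_cancel]
    exact x.total
  chain := by
    classical
    have key : ∀ a ∈ ((x.weight - x.topMass t).mapDomain f).support,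
        ∀ b ∈ ((x.topMass t).mapDomain g).support, a ≤ b := by
      intro a ha b hb
      obtain ⟨p, hp, rfl⟩ := Finsupp.exists_of_mem_support_mapDomain ha
      obtain ⟨q, hq, rfl⟩ := Finsupp.exists_of_mem_support_mapDomain hb
      rcases eq_or_ne p q with rfl | hne
      · exact hfg p
      rcases x.chain (sub_topMass_support x t hp) (topMass_support x t hq) hne with h | h
      · exact (hfg p).trans (g.monotone h)
      -- Here `q < p`, while part of `q` is moved by `g` and part of `p` is left to `f`. The
      -- stacking forbids this: `t < massAbove p + weight p ≤ massAbove q < t`.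
      exfalso
      have h1 := x.massAbove_add_le (lt_of_le_of_ne h hne.symm)
      have h2 : 0 < x.topMass t q :=
        lt_of_le_of_ne (x.topMass_nonneg t q) (Finsupp.mem_support_iff.1 hq).symm
      have h3 : x.topMass t p < x.weight p := by
        refine lt_of_le_of_ne (x.topMass_le t p) fun e => ?_
        exact Finsupp.mem_support_iff.1 hp (by rw [Finsupp.sub_apply, e, sub_self])
      rw [topMass_apply, lt_min_iff, lt_max_iff] at h2
      rw [topMass_apply, min_lt_iff, max_lt_iff] at h3
      have h4 := h2.2.resolve_left (lt_irrefl _)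
      have h5 := (h3.resolve_left (lt_irrefl _)).2
      linarith
    intro a ha b hb _
    rcases Finset.mem_union.1 (Finsupp.support_add ha) with ha | ha <;>
      rcases Finset.mem_union.1 (Finsupp.support_add hb) with hb | hb
    · obtain ⟨p, hp, rfl⟩ := Finsupp.exists_of_mem_support_mapDomain ha
      obtain ⟨q, hq, rfl⟩ := Finsupp.exists_of_mem_support_mapDomain hb
      exact (x.chain.total (sub_topMass_support x t hp) (sub_topMass_support x t hq)).imp
        (fun h => f.monotone h) fun h => f.monotone h
    · exact Or.inl (key a ha b hb)
    · exact Or.inr (key b hb a ha)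
    · obtain ⟨p, hp, rfl⟩ := Finsupp.exists_of_mem_support_mapDomain ha
      obtain ⟨q, hq, rfl⟩ := Finsupp.exists_of_mem_support_mapDomain hb
      exact (x.chain.total (topMass_support x t hp) (topMass_support x t hq)).imp
        (fun h => g.monotone h) fun h => g.monotone h

section prism

variable {Q : Type*} [PartialOrder Q] {f g : P →o Q} (hfg : ∀ p, f p ≤ g p)

theorem prism_zero (x : Realization P) : prism hfg 0 x = map f x := by
  apply Realization.ext
  change (x.weight - x.topMass 0).mapDomain f + (x.topMass 0).mapDomain g = x.weight.mapDomain f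
  rw [topMass_zero, sub_zero, Finsupp.mapDomain_zero, add_zero]

theorem prism_one (x : Realization P) : prism hfg 1 x = map g x := by
  apply Realization.ext
  change (x.weight - x.topMass 1).mapDomain f + (x.topMass 1).mapDomain g = x.weight.mapDomain g
  rw [topMass_one, sub_self, Finsupp.mapDomain_zero, zero_add]

theorem prism_mem_simplex [DecidableEq Q] {s : Finset P} {x : Realization P} (hx : x ∈ simplex s)
    (t : ℝ) : prism hfg t x ∈ simplex (s.image f ∪ s.image g) :=
  Finsupp.support_add.trans (Finset.union_subset_union
    (Finsupp.mapDomain_support.trans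
      (Finset.image_subset_image ((sub_topMass_support x t).trans hx)))
    (Finsupp.mapDomain_support.trans (Finset.image_subset_image ((topMass_support x t).trans hx))))

theorem continuous_prism_simplex (s : Finset P) :
    Continuous fun z : simplex s × unitInterval => prism hfg z.2 z.1.1 := by
  classical
  refine continuous_of_weight _ (fun z => prism_mem_simplex hfg z.1.2 z.2) fun q => ?_
  have hw : ∀ p, Continuous fun z : simplex s × unitInterval => z.1.1.weight p := fun p =>
    (continuous_weight p).comp (continuous_subtype_val.comp continuous_fst)
  have ht : ∀ p, Continuous fun z : simplex s × unitInterval => z.1.1.topMass z.2 p := fun p => by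
    have h1 : ∀ z : simplex s × unitInterval, z.1.1.topMass z.2 p = min (z.1.1.weight p)
        (max 0 (z.2 - ∑ q ∈ s, if p < q then z.1.1.weight q else 0)) := fun z => by
      rw [topMass_apply, massAbove_eq_sum z.1.2]
    simp only [h1]
    refine (hw p).min (continuous_const.max
      ((continuous_subtype_val.comp continuous_snd).sub (continuous_finsetSum _ fun q _ => ?_)))
    split_ifs
    exacts [hw q, continuous_const]
  have h : ∀ z : simplex s × unitInterval, (prism hfg z.2 z.1.1).weight q =
      (∑ p ∈ s, if f p = q then z.1.1.weight p - z.1.1.topMass z.2 p else 0) +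
        ∑ p ∈ s, if g p = q then z.1.1.topMass z.2 p else 0 := fun z => by
    change ((z.1.1.weight - z.1.1.topMass z.2).mapDomain f + (z.1.1.topMass z.2).mapDomain g) q = _
    rw [Finsupp.add_apply,
      Finsupp.mapDomain_apply_eq_sum_of_subset f ((sub_topMass_support _ _).trans z.1.2),
      Finsupp.mapDomain_apply_eq_sum_of_subset g ((topMass_support _ _).trans z.1.2)]
    simp only [Finsupp.sub_apply]
  simp only [h]
  refine (continuous_finsetSum _ fun p _ => ?_).add (continuous_finsetSum _ fun p _ => ?_) <;>
    split_ifs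
  exacts [(hw p).sub (ht p), continuous_const, ht p, continuous_const]

/-- The weak topology only tests maps out of the realisation itself, not out of its product with the
interval. Currying to a map into `C(unitInterval, Realization Q)` allows a check simplex by simplex;
evaluation then recovers joint continuity. -/
theorem continuous_prism :
    Continuous fun z : unitInterval × Realization P => prism hfg z.1 z.2 := by
  have h0 : ∀ (s : Finset P) (y : simplex s),
      Continuous fun t : unitInterval => prism hfg t y.1 := fun s y => by
    have hy : Continuous fun t : unitInterval => (y, t) := by fun_prop
    have h := (continuous_prism_simplex hfg s).comp hy
    exact h
  have h1 : ∀ x : Realization P, Continuous fun t : unitInterval => prism hfg t x := fun x =>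
    h0 x.weight.support ⟨x, mem_simplex.2 (Finset.Subset.refl _)⟩
  have h2 : Continuous fun x : Realization P =>
      (⟨fun t => prism hfg t x, h1 x⟩ : C(unitInterval, Realization Q)) := by
    refine continuous_iff_continuousOn_simplex.2 fun s _ =>
      continuousOn_iff_continuous_domRestrict.2 ?_
    refine ContinuousMap.continuous_of_continuous_uncurry _ ?_
    have h3 := continuous_prism_simplex hfg s
    exact h3
  exact (h2.comp continuous_snd).eval continuous_fst

end prism

/-! ### Homotopies and contractions on the part spanned by a set of vertices. -/

theorem map_id (x : Realization P) : map OrderHom.id x = x :=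
  Realization.ext Finsupp.mapDomain_id

/-- The points whose vertices lie in `S`. -/
def supportedIn (S : Set P) : Set (Realization P) := {x | (x.weight.support : Set P) ⊆ S}

theorem prism_mem_supportedIn {Q : Type*} [PartialOrder Q] {f g : P →o Q} (hfg : ∀ p, f p ≤ g p)
    {S : Set P} {S' : Set Q} (hf : MapsTo f S S') (hg : MapsTo g S S') {x : Realization P}
    (hx : x ∈ supportedIn S) (t : ℝ) : prism hfg t x ∈ supportedIn S' := by
  classical
  intro q hq
  have h := prism_mem_simplex hfg (mem_simplex.2 (Finset.Subset.refl x.weight.support)) t hq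
  rcases Finset.mem_union.1 h with h | h <;> obtain ⟨p, hp, rfl⟩ := Finset.mem_image.1 h
  exacts [hf (hx hp), hg (hx hp)]

theorem map_mem_supportedIn {Q : Type*} [PartialOrder Q] {f : P →o Q}
    {S : Set P} {S' : Set Q} (hf : MapsTo f S S') {x : Realization P}
    (hx : x ∈ supportedIn S) : map f x ∈ supportedIn S' := by
  rw [← prism_zero (f := f) (g := f) fun _ => le_rfl]
  exact prism_mem_supportedIn _ hf hf hx 0

/-- The restriction of `map f` to the points supported in an invariant set. -/
noncomputable def mapSupportedIn {S : Set P} (f : P →o P) (hf : MapsTo f S S) :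
    C(supportedIn S, supportedIn S) where
  toFun x := ⟨map f x, map_mem_supportedIn hf x.2⟩
  continuous_toFun := ((continuous_map f).comp continuous_subtype_val).subtype_mk _

theorem mapSupportedIn_homotopic {S : Set P} {f g : P →o P} (hfg : ∀ p, f p ≤ g p)
    (hf : MapsTo f S S) (hg : MapsTo g S S) :
    (mapSupportedIn f hf).Homotopic (mapSupportedIn g hg) :=
  ⟨{ toFun z := ⟨prism hfg z.1 z.2, prism_mem_supportedIn hfg hf hg z.2.2 z.1⟩
     continuous_toFun := ((continuous_prism hfg).comp (continuous_fst.prodMk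
       (continuous_subtype_val.comp continuous_snd))).subtype_mk _
     map_zero_left x := Subtype.ext (prism_zero hfg x.1)
     map_one_left x := Subtype.ext (prism_one hfg x.1) }⟩

/-- The vertex of the realisation given by an element of the poset. -/
noncomputable def vertex (a : P) : Realization P where
  weight := Finsupp.single a 1
  nonneg p := by
    classical
    rw [Finsupp.single_apply]
    split_ifs
    exacts [zero_le_one, le_rfl]
  total := by simp
  chain := by
    rw [Finsupp.support_single _ one_ne_zero, Finset.coe_singleton]
    exact IsChain.singleton

/-- Quillen's conical contractibility. -/
theorem contractibleSpace_supportedIn {S : Set P} {a : P} (haS : a ∈ S) (j : P →o P)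
    (hjS : MapsTo j S S) (hj : ∀ p, p ≤ j p) (ha : ∀ p, a ≤ j p) :
    ContractibleSpace (supportedIn S) := by
  rw [contractible_iff_id_nullhomotopic]
  have h0 : ContinuousMap.id (supportedIn S) = mapSupportedIn OrderHom.id (mapsTo_id S) :=
    ContinuousMap.ext fun x => Subtype.ext (map_id x.1).symm
  have hc : MapsTo (OrderHom.const P a) S S := fun _ _ => haS
  have h1 : ∀ x : Realization P, (map (OrderHom.const P a) x).weight = Finsupp.single a 1 :=
    fun x => by
      change x.weight.mapDomain (fun _ => a) = _
      rw [Finsupp.mapDomain, ← x.total]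
      exact (Finsupp.single_finsetSum _ _ _).symm
  have hy : vertex a ∈ supportedIn S := by
    intro p hp
    rw [Finset.mem_singleton.1 (Finsupp.support_single_subset hp)]
    exact haS
  refine ⟨⟨vertex a, hy⟩, ?_⟩
  have h2 : ContinuousMap.const _ ⟨vertex a, hy⟩ = mapSupportedIn (OrderHom.const P a) hc :=
    ContinuousMap.ext fun x => Subtype.ext (Realization.ext (h1 x.1).symm)
  rw [h0, h2]
  -- Two prisms: from the identity up to `j`, then from `j` down to the constant map at `a`.
  exact (mapSupportedIn_homotopic hj (mapsTo_id S) hjS).trans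
    (mapSupportedIn_homotopic ha hc hjS).symm

end Realization

/-! ### The standard simplex as a ball. -/

/-- The barycentric coordinates of a point of `ℝ ^ k` with respect to the origin and the standard
basis. -/
def barycentric {k : ℕ} (y : Fin k → ℝ) : Fin (k + 1) → ℝ := Fin.cons (1 - ∑ i, y i) y

theorem barycentric_tail {k : ℕ} {v : Fin (k + 1) → ℝ} (hv : ∑ j, v j = 1) :
    barycentric (fun i => v i.succ) = v := by
  rw [Fin.sum_univ_succ] at hv
  funext j
  refine Fin.cases ?_ (fun i => ?_) j
  · simp only [barycentric, Fin.cons_zero]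
    linarith
  · simp only [barycentric, Fin.cons_succ]

theorem sum_barycentric {k : ℕ} (y : Fin k → ℝ) : ∑ j, barycentric y j = 1 := by
  simp [barycentric, Fin.sum_univ_succ]

theorem continuous_barycentric {k : ℕ} (j : Fin (k + 1)) :
    Continuous fun y : Fin k → ℝ => barycentric y j := by
  refine Fin.cases ?_ (fun i => ?_) j
  · simp only [barycentric, Fin.cons_zero]
    fun_prop
  · simp only [barycentric, Fin.cons_succ]
    fun_prop

theorem barycentric_affine {k : ℕ} (a b : ℝ) (hab : a + b = 1) (y z : Fin k → ℝ) (j : Fin (k + 1)) :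
    barycentric (a • y + b • z) j = a * barycentric y j + b * barycentric z j := by
  refine Fin.cases ?_ (fun i => ?_) j
  · simp only [barycentric, Fin.cons_zero, Pi.add_apply, Pi.smul_apply, smul_eq_mul,
      Finset.sum_add_distrib, ← Finset.mul_sum]
    linear_combination -hab
  · simp only [barycentric, Fin.cons_succ, Pi.add_apply, Pi.smul_apply, smul_eq_mul]

theorem exists_barycentric_pos (k : ℕ) : ∃ c : Fin k → ℝ, ∀ j, 0 < barycentric c j := by
  let v : Fin (k + 1) → ℝ := fun _ => ((k : ℝ) + 1)⁻¹
  have hv : ∑ j, v j = 1 := by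
    simp [v, mul_inv_cancel₀ (Nat.cast_add_one_ne_zero (R := ℝ) k)]
  refine ⟨fun i => v i.succ, fun j => ?_⟩
  rw [barycentric_tail hv]
  positivity

/-- An interior point `y` can be pushed slightly away from a point `c` with positive coordinates
without leaving the simplex. Then `(1 + t) y - t c` has nonnegative coordinates for some `t > 0`,
which forces those of `y` to be positive. -/
theorem interior_setOf_barycentric_nonneg (k : ℕ) :
    interior {y : Fin k → ℝ | ∀ j, 0 ≤ barycentric y j} = {y | ∀ j, 0 < barycentric y j} := by
  apply Subset.antisymm
  · intro y hy j
    obtain ⟨c, hc⟩ := exists_barycentric_pos k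
    have hcont : Continuous fun t : ℝ => (1 + t) • y + (-t) • c := by fun_prop
    have hmem : ∀ᶠ t in 𝓝 (0 : ℝ), (1 + t) • y + (-t) • c ∈
        {y : Fin k → ℝ | ∀ j, 0 ≤ barycentric y j} := by
      refine hcont.continuousAt.eventually_mem ?_
      simpa using mem_interior_iff_mem_nhds.1 hy
    obtain ⟨t, ht, htpos⟩ := ((hmem.filter_mono nhdsWithin_le_nhds).and
      (self_mem_nhdsWithin (s := Ioi (0 : ℝ)))).exists
    have h1 := ht j
    rw [barycentric_affine _ _ (by ring)] at h1
    have h2 : 0 < t * barycentric c j := mul_pos htpos (hc j)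
    have h3 : 0 < (1 + t) * barycentric y j := by linarith
    exact pos_of_mul_pos_right h3 (by linarith [show 0 < t from htpos])
  · refine interior_maximal (fun y hy j => (hy j).le) ?_
    simp only [ofPred_forall]
    exact isOpen_iInter_of_finite fun j => isOpen_lt continuous_const (continuous_barycentric j)

/-- The simplex is closed, bounded and convex with non-empty interior, so a homeomorphism of the
whole space carries it to the unit ball, respecting interiors. -/
theorem exists_homeomorph_barycentric (k : ℕ) : ∃ h : (Fin k → ℝ) ≃ₜ (Fin k → ℝ),
    (∀ y, y ∈ Metric.closedBall (0 : Fin k → ℝ) 1 ↔ ∀ j, 0 ≤ barycentric (h y) j) ∧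
    (∀ y, y ∈ Metric.ball (0 : Fin k → ℝ) 1 ↔ ∀ j, 0 < barycentric (h y) j) := by
  let D : Set (Fin k → ℝ) := {y | ∀ j, 0 ≤ barycentric y j}
  have hD : IsClosed D := by
    simp only [D, ofPred_forall]
    exact isClosed_iInter fun j => isClosed_le continuous_const (continuous_barycentric j)
  have hconv : Convex ℝ D := fun y hy z hz a b ha hb hab j => by
    rw [barycentric_affine a b hab]
    exact add_nonneg (mul_nonneg ha (hy j)) (mul_nonneg hb (hz j))
  have hne : (interior D).Nonempty := by
    rw [interior_setOf_barycentric_nonneg]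
    exact exists_barycentric_pos k
  have hb : Bornology.IsBounded D := by
    refine (Metric.isBounded_closedBall (x := (0 : Fin k → ℝ)) (r := 1)).subset fun y hy => ?_
    rw [mem_closedBall_zero_iff, pi_norm_le_iff_of_nonneg zero_le_one]
    intro i
    have h1 : barycentric y i.succ ≤ ∑ j, barycentric y j :=
      Finset.single_le_sum (fun j _ => hy j) (Finset.mem_univ _)
    rw [sum_barycentric] at h1
    have h2 := hy i.succ
    simp only [barycentric, Fin.cons_succ] at h1 h2
    rwa [Real.norm_of_nonneg h2]
  obtain ⟨h, h1, h2, -⟩ :=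
    exists_homeomorph_image_interior_closure_frontier_eq_unitBall hconv hne hb
  rw [hD.closure_eq] at h2
  rw [interior_setOf_barycentric_nonneg] at h1
  refine ⟨h.symm, fun y => ?_, fun y => ?_⟩
  · rw [← h2, ← h.preimage_symm]
    rfl
  · rw [← h1, ← h.preimage_symm]
    rfl

/-- A homeomorphism of `ℝ ^ k` that carries the unit ball to the standard simplex. -/
noncomputable def ballHomeomorph (k : ℕ) : (Fin k → ℝ) ≃ₜ (Fin k → ℝ) :=
  (exists_homeomorph_barycentric k).choose

theorem mem_closedBall_iff_barycentric {k : ℕ} {y : Fin k → ℝ} :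
    y ∈ Metric.closedBall (0 : Fin k → ℝ) 1 ↔ ∀ j, 0 ≤ barycentric (ballHomeomorph k y) j :=
  (exists_homeomorph_barycentric k).choose_spec.1 y

theorem mem_ball_iff_barycentric {k : ℕ} {y : Fin k → ℝ} :
    y ∈ Metric.ball (0 : Fin k → ℝ) 1 ↔ ∀ j, 0 < barycentric (ballHomeomorph k y) j :=
  (exists_homeomorph_barycentric k).choose_spec.2 y

/-! ### The CW structure. -/

namespace Realization

universe u

variable {P : Type u} [PartialOrder P]

/-- The chains of `k + 1` elements. -/
abbrev Chains (P : Type u) [PartialOrder P] (k : ℕ) : Type u :=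
  {s : Finset P // IsChain (· ≤ ·) (s : Set P) ∧ s.card = k + 1}

section charMap

variable {k : ℕ} (σ : Chains P k)

/-- An enumeration of the elements of a chain. -/
noncomputable def equivFin : σ.1 ≃ Fin (k + 1) := σ.1.equivFinOfCardEq σ.2.2

open scoped Classical in
/-- The point of a simplex with given barycentric coordinates. -/
noncomputable def ofCoords (v : Fin (k + 1) → ℝ) (h0 : ∀ j, 0 ≤ v j) (h1 : ∑ j, v j = 1) :
    Realization P where
  weight := Finsupp.onFinset σ.1 (fun p => if hp : p ∈ σ.1 then v (equivFin σ ⟨p, hp⟩) else 0)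
    fun p hp => by
      by_contra h
      exact hp (dif_neg h)
  nonneg p := by
    rw [Finsupp.onFinset_apply]
    split_ifs
    exacts [h0 _, le_rfl]
  total := by
    rw [Finsupp.onFinset_sum _ (fun _ => rfl), ← h1, ← (equivFin σ).sum_comp, ← Finset.sum_coe_sort]
    exact Finset.sum_congr rfl fun p _ => dif_pos p.2
  chain := σ.2.1.mono (Finset.coe_subset.2 Finsupp.support_onFinset_subset)

theorem ofCoords_mem (v : Fin (k + 1) → ℝ) (h0 : ∀ j, 0 ≤ v j) (h1 : ∑ j, v j = 1) :
    ofCoords σ v h0 h1 ∈ simplex σ.1 := by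
  intro p hp
  by_contra h
  exact Finsupp.mem_support_iff.1 hp (dif_neg h)

theorem ofCoords_weight (v : Fin (k + 1) → ℝ) (h0 : ∀ j, 0 ≤ v j) (h1 : ∑ j, v j = 1)
    (j : Fin (k + 1)) : (ofCoords σ v h0 h1).weight ((equivFin σ).symm j) = v j := by
  have h : (ofCoords σ v h0 h1).weight ((equivFin σ).symm j) = _ := dif_pos ((equivFin σ).symm j).2
  rw [h]
  exact congrArg v ((equivFin σ).apply_symm_apply j)

theorem ext_simplex {x y : Realization P} (hx : x ∈ simplex σ.1) (hy : y ∈ simplex σ.1)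
    (h : ∀ j, x.weight ((equivFin σ).symm j) = y.weight ((equivFin σ).symm j)) : x = y := by
  refine Realization.ext (Finsupp.ext fun p => ?_)
  by_cases hp : p ∈ σ.1
  · simpa using h (equivFin σ ⟨p, hp⟩)
  · rw [weight_eq_zero hx hp, weight_eq_zero hy hp]

theorem sum_weight_equivFin {x : Realization P} (hx : x ∈ simplex σ.1) :
    ∑ j, x.weight ((equivFin σ).symm j) = 1 := by
  rw [← sum_weight hx, ← Finset.sum_coe_sort σ.1]
  exact (equivFin σ).symm.sum_comp fun p => x.weight p

open scoped Classical in
/-- The characteristic map of a simplex. -/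
noncomputable def charMap (y : Fin k → ℝ) : Realization P :=
  if h : ∀ j, 0 ≤ barycentric (ballHomeomorph k y) j then
    ofCoords σ (barycentric (ballHomeomorph k y)) h (sum_barycentric _)
  -- The value off the closed ball is a vertex of the simplex, so that `charMap_mem` holds without
  -- any condition on `y`.
  else ofCoords σ (Pi.single 0 1)
    (fun j => (Pi.single_nonneg.2 zero_le_one : (0 : Fin (k + 1) → ℝ) ≤ Pi.single 0 1) j) (by simp)

/-- The inverse of the characteristic map of a simplex. -/
noncomputable def charInv (x : Realization P) : Fin k → ℝ :=
  (ballHomeomorph k).symm fun i => x.weight ((equivFin σ).symm i.succ)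

theorem charMap_mem (y : Fin k → ℝ) : charMap σ y ∈ simplex σ.1 := by
  rw [charMap]
  split_ifs <;> exact ofCoords_mem _ _ _ _

theorem charMap_weight {y : Fin k → ℝ} (hy : y ∈ Metric.closedBall (0 : Fin k → ℝ) 1)
    (j : Fin (k + 1)) :
    (charMap σ y).weight ((equivFin σ).symm j) = barycentric (ballHomeomorph k y) j := by
  rw [charMap, dif_pos (mem_closedBall_iff_barycentric.1 hy), ofCoords_weight]

theorem barycentric_charInv {x : Realization P} (hx : x ∈ simplex σ.1) (j : Fin (k + 1)) :
    barycentric (ballHomeomorph k (charInv σ x)) j = x.weight ((equivFin σ).symm j) := by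
  rw [charInv, Homeomorph.apply_symm_apply,
    barycentric_tail (v := fun j => x.weight ((equivFin σ).symm j)) (sum_weight_equivFin σ hx)]

theorem charInv_mem {x : Realization P} (hx : x ∈ simplex σ.1) :
    charInv σ x ∈ Metric.closedBall (0 : Fin k → ℝ) 1 :=
  mem_closedBall_iff_barycentric.2 fun j => by
    rw [barycentric_charInv σ hx]
    exact x.nonneg _

theorem charMap_charInv {x : Realization P} (hx : x ∈ simplex σ.1) :
    charMap σ (charInv σ x) = x :=
  ext_simplex σ (charMap_mem σ _) hx fun j => by
    rw [charMap_weight σ (charInv_mem σ hx), barycentric_charInv σ hx]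

theorem charInv_charMap {y : Fin k → ℝ} (hy : y ∈ Metric.closedBall (0 : Fin k → ℝ) 1) :
    charInv σ (charMap σ y) = y := by
  rw [charInv, Homeomorph.symm_apply_eq]
  funext i
  rw [charMap_weight σ hy, barycentric, Fin.cons_succ]

theorem image_charMap_closedBall :
    charMap σ '' Metric.closedBall (0 : Fin k → ℝ) 1 = simplex σ.1 := by
  apply Subset.antisymm
  · rintro _ ⟨y, -, rfl⟩
    exact charMap_mem σ y
  · exact fun x hx => ⟨_, charInv_mem σ hx, charMap_charInv σ hx⟩

theorem support_eq_iff {x : Realization P} (hx : x ∈ simplex σ.1) :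
    x.weight.support = σ.1 ↔ ∀ j, 0 < x.weight ((equivFin σ).symm j) := by
  refine ⟨fun h j => lt_of_le_of_ne (x.nonneg _) (Ne.symm ?_), fun h => ?_⟩
  · rw [← Finsupp.mem_support_iff, h]
    exact ((equivFin σ).symm j).2
  · refine Finset.Subset.antisymm hx fun p hp => Finsupp.mem_support_iff.2 ?_
    simpa using (h (equivFin σ ⟨p, hp⟩)).ne'

/-- The characteristic map of a simplex as a partial equivalence. -/
noncomputable def charEquiv : PartialEquiv (Fin k → ℝ) (Realization P) where
  toFun := charMap σ
  invFun := charInv σ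
  source := Metric.ball 0 1
  target := {x | x.weight.support = σ.1}
  map_source' y hy := by
    refine (support_eq_iff σ (charMap_mem σ y)).2 fun j => ?_
    rw [charMap_weight σ (Metric.ball_subset_closedBall hy)]
    exact mem_ball_iff_barycentric.1 hy j
  map_target' x hx := by
    have h : x ∈ simplex σ.1 := Finset.Subset.antisymm_iff.1 hx |>.1
    refine mem_ball_iff_barycentric.2 fun j => ?_
    rw [barycentric_charInv σ h]
    exact (support_eq_iff σ h).1 hx j
  left_inv' y hy := charInv_charMap σ (Metric.ball_subset_closedBall hy)
  right_inv' x hx := charMap_charInv σ (Finset.Subset.antisymm_iff.1 hx).1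

theorem image_charEquiv_ball :
    charEquiv σ '' Metric.ball (0 : Fin k → ℝ) 1 = {x | x.weight.support = σ.1} :=
  (charEquiv σ).image_source_eq_target

theorem continuousOn_charMap : ContinuousOn (charMap σ) (Metric.closedBall (0 : Fin k → ℝ) 1) := by
  refine continuousOn_of_simplex σ.2.1 (fun y _ => charMap_mem σ y) fun p => ?_
  by_cases hp : p ∈ σ.1
  · have h : ContinuousOn
        (fun y => barycentric (ballHomeomorph k y) (equivFin σ ⟨p, hp⟩))
        (Metric.closedBall (0 : Fin k → ℝ) 1) :=
      ((continuous_barycentric _).comp (ballHomeomorph k).continuous).continuousOn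
    refine h.congr fun y hy => ?_
    simpa using charMap_weight σ hy (equivFin σ ⟨p, hp⟩)
  · refine (continuousOn_const (c := (0 : ℝ))).congr fun y _ => ?_
    exact weight_eq_zero (charMap_mem σ y) hp

theorem continuous_charInv : Continuous (charInv σ) :=
  (ballHomeomorph k).symm.continuous.comp (continuous_pi fun _ => continuous_weight _)

theorem finite_faces (m : ℕ) : {τ : Chains P m | τ.1 ⊆ σ.1}.Finite := by
  classical
  refine Set.Finite.of_finite_image (f := fun τ => τ.1)
    ((Finset.finite_toSet σ.1.powerset).subset ?_) fun a _ b _ h => Subtype.ext h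
  rintro _ ⟨τ, hτ, rfl⟩
  exact Finset.mem_coe.2 (Finset.mem_powerset.2 hτ)

end charMap

/-- The vertices of a point form a chain. -/
theorem exists_chain_eq_support (x : Realization P) :
    ∃ (m : ℕ) (τ : Chains P m), τ.1 = x.weight.support :=
  ⟨x.weight.support.card - 1, ⟨x.weight.support, x.chain, by
    have := Finset.card_pos.2 x.support_nonempty
    omega⟩, rfl⟩

/-- The realisation of a poset is a CW-complex whose cells are its simplices. -/
@[reducible]
noncomputable def cwComplex (P : Type u) [PartialOrder P] :
    CWComplex (univ : Set (Realization P)) where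
  cell := Chains P
  map _ σ := charEquiv σ
  source_eq _ _ := rfl
  continuousOn _ σ := continuousOn_charMap σ
  continuousOn_symm _ σ := (continuous_charInv σ).continuousOn
  pairwiseDisjoint' := by
    rintro ⟨m, σ⟩ - ⟨m', τ⟩ - hne
    rw [Function.onFun, image_charEquiv_ball, image_charEquiv_ball, Set.disjoint_left]
    intro x hx hx'
    have h : σ.1 = τ.1 := hx.symm.trans hx'
    have hm : m = m' := by
      have := σ.2.2
      rw [h, τ.2.2] at this
      omega
    subst hm
    exact hne (by rw [Subtype.ext h])
  mapsTo' m σ := by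
    refine ⟨fun m' => (finite_faces σ m').toFinset, fun y hy => ?_⟩
    -- The support of the image of a boundary point is a face `τ`. Were it all of `σ`, every
    -- coordinate would be positive and `y` would lie in the open ball.
    obtain ⟨m', τ, hτ⟩ := exists_chain_eq_support (charMap σ y)
    have hsub : τ.1 ⊆ σ.1 := hτ ▸ charMap_mem σ y
    have hlt : m' < m := by
      have hle := Finset.card_le_card hsub
      rw [τ.2.2, σ.2.2] at hle
      refine lt_of_le_of_ne (by omega) fun h => ?_
      have heq := Finset.eq_of_subset_of_card_le hsub (by rw [τ.2.2, σ.2.2, h])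
      have hpos := (support_eq_iff σ (charMap_mem σ y)).1 (hτ.symm.trans heq)
      simp only [charMap_weight σ (Metric.sphere_subset_closedBall hy)] at hpos
      have := mem_ball_iff_barycentric.2 hpos
      rw [mem_ball_zero_iff] at this
      rw [mem_sphere_zero_iff_norm] at hy
      linarith
    simp only [mem_iUnion]
    refine ⟨m', hlt, τ, (finite_faces σ m').mem_toFinset.2 hsub, ?_⟩
    change charMap σ y ∈ charMap τ '' _
    rw [image_charMap_closedBall]
    exact hτ.ge
  closed' A _ h := by
    refine isClosed_of_inter_simplex fun s hs => ?_
    -- The empty chain corresponds to no cell, but its simplex has no points because the total mass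
    -- is `1`.
    rcases s.eq_empty_or_nonempty with rfl | hne
    · convert isClosed_empty
      refine eq_empty_of_forall_notMem fun x hx => ?_
      exact x.support_nonempty.ne_empty (Finset.subset_empty.1 hx.2)
    · have := Finset.card_pos.2 hne
      have h1 := h (s.card - 1) ⟨s, hs, by omega⟩
      have h2 := image_charMap_closedBall ⟨s, hs, by omega⟩ (k := s.card - 1)
      exact h2 ▸ h1
  union' := by
    refine eq_univ_of_forall fun x => ?_
    obtain ⟨m, τ, hτ⟩ := exists_chain_eq_support x
    simp only [mem_iUnion]
    refine ⟨m, τ, ?_⟩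
    change x ∈ charMap τ '' _
    rw [image_charMap_closedBall]
    exact hτ.ge

theorem closedCell_cwComplex {k : ℕ} (σ : Chains P k) :
    letI := cwComplex P
    RelCWComplex.closedCell (C := (univ : Set (Realization P))) k σ = simplex σ.1 :=
  image_charMap_closedBall σ

theorem openCell_cwComplex {k : ℕ} (σ : Chains P k) :
    letI := cwComplex P
    RelCWComplex.openCell (C := (univ : Set (Realization P))) k σ =
      {x | x.weight.support = σ.1} :=
  image_charEquiv_ball σ

theorem range_closedCell_cwComplex (k : ℕ) :
    letI := cwComplex P
    Set.range (RelCWComplex.closedCell (C := (univ : Set (Realization P))) k) =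
      {A | ∃ s : Finset P, IsChain (· ≤ ·) (s : Set P) ∧ s.card = k + 1 ∧ A = simplex s} := by
  ext A
  constructor
  · rintro ⟨σ, rfl⟩
    exact ⟨σ.1, σ.2.1, σ.2.2, closedCell_cwComplex σ⟩
  · rintro ⟨s, hs, hc, rfl⟩
    exact ⟨(⟨s, hs, hc⟩ : Chains P k), closedCell_cwComplex ⟨s, hs, hc⟩⟩

/-! ### Group actions -/

section action

variable {G : Type*} [Group G] [MulAction G P] [CovariantClass G P HSMul.hSMul LE.le]

theorem smul_weight (g : G) (x : Realization P) :
    (g • x).weight = x.weight.mapDomain (g • ·) := rfl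

theorem smul_support (g : G) (x : Realization P) :
    (g • x).weight.support = x.weight.support.map (MulAction.toPerm g).toEmbedding := by
  classical
  rw [smul_weight, Finsupp.mapDomain_support_of_injective (MulAction.injective g),
    Finset.map_eq_image]
  rfl

/-- An automorphism of a poset that maps a finite chain to itself fixes its elements. -/
theorem smul_eq_of_isChain {s : Finset P} (hs : IsChain (· ≤ ·) (s : Set P)) {g : G}
    (hg : ∀ p ∈ s, g • p ∈ s) {p : P} (hp : p ∈ s) : g • p = p := by
  classical
  have hlt : ∀ {a b : P}, a < b → g • a < g • b := fun {a b} h =>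
    lt_of_le_of_ne (CovariantClass.elim g h.le) fun e => h.ne (MulAction.injective g e)
  by_contra hne
  -- If `g • p < p`, then `g` injects the elements of `s` below `p` into the strictly smaller set of
  -- those below `g • p`, contradicting finiteness. The other case is dual.
  rcases hs (hg p hp) hp hne with h | h
  · have h1 : ({q ∈ s | q < p}).card ≤ ({q ∈ s | q < g • p}).card :=
      Finset.card_le_card_of_injOn (g • ·)
        (fun q hq => by
          have hq' := Finset.mem_filter.1 (Finset.mem_coe.1 hq)
          exact Finset.mem_coe.2 (Finset.mem_filter.2 ⟨hg q hq'.1, hlt hq'.2⟩))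
        (MulAction.injective g).injOn
    have h2 : {q ∈ s | q < g • p} ⊂ {q ∈ s | q < p} := by
      refine Finset.ssubset_iff_subset_ne.2
        ⟨Finset.monotone_filter_right _ fun q _ hq => hq.trans_le h, fun e => ?_⟩
      have h3 : g • p ∈ {q ∈ s | q < p} :=
        Finset.mem_filter.2 ⟨hg p hp, lt_of_le_of_ne h hne⟩
      rw [← e] at h3
      exact lt_irrefl _ (Finset.mem_filter.1 h3).2
    exact absurd (Finset.card_lt_card h2) (not_lt.2 h1)
  · have h1 : ({q ∈ s | p < q}).card ≤ ({q ∈ s | g • p < q}).card :=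
      Finset.card_le_card_of_injOn (g • ·)
        (fun q hq => by
          have hq' := Finset.mem_filter.1 (Finset.mem_coe.1 hq)
          exact Finset.mem_coe.2 (Finset.mem_filter.2 ⟨hg q hq'.1, hlt hq'.2⟩))
        (MulAction.injective g).injOn
    have h2 : {q ∈ s | g • p < q} ⊂ {q ∈ s | p < q} := by
      refine Finset.ssubset_iff_subset_ne.2
        ⟨Finset.monotone_filter_right _ fun q _ hq => h.trans_lt hq, fun e => ?_⟩
      have h3 : g • p ∈ {q ∈ s | p < q} :=
        Finset.mem_filter.2 ⟨hg p hp, lt_of_le_of_ne h (Ne.symm hne)⟩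
      rw [← e] at h3
      exact lt_irrefl _ (Finset.mem_filter.1 h3).2
    exact absurd (Finset.card_lt_card h2) (not_lt.2 h1)

theorem smul_eq_self_of_forall {g : G} {x : Realization P}
    (h : ∀ p ∈ x.weight.support, g • p = p) : g • x = x := by
  apply Realization.ext
  rw [smul_weight, Finsupp.mapDomain_congr (g := id) h, Finsupp.mapDomain_id]

theorem smul_eq_of_smul_mem_simplex {s : Finset P} (hs : IsChain (· ≤ ·) (s : Set P)) {g : G}
    {x : Realization P} (hx : x.weight.support = s) (h : g • x ∈ simplex s) {p : P} (hp : p ∈ s) :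
    g • p = p := by
  refine smul_eq_of_isChain hs (fun q hq => ?_) hp
  rw [mem_simplex, smul_support, hx] at h
  exact h (Finset.mem_map_of_mem (MulAction.toPerm g).toEmbedding hq)

theorem smul_eq_self_iff {g : G} {x : Realization P} :
    g • x = x ↔ ∀ p ∈ x.weight.support, g • p = p := by
  refine ⟨fun h p hp => ?_, smul_eq_self_of_forall⟩
  exact smul_eq_of_smul_mem_simplex x.chain rfl (h.symm ▸ Finset.Subset.refl _) hp

/-- An element fixing a point preserves its support, a finite chain, and therefore fixes every
vertex in it. -/
theorem fixedPoints_eq_supportedIn (Q : Subgroup G) :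
    MulAction.fixedPoints Q (Realization P) = supportedIn (MulAction.fixedPoints Q P) := by
  ext x
  constructor
  · intro h p hp q
    exact smul_eq_self_iff (g := (q : G)).1 (h q) p hp
  · intro h q
    exact smul_eq_self_of_forall (g := (q : G)) fun p hp => h hp q

/-- Testing the stabiliser on the vertices of the simplex shows that it preserves the chain `s`. -/
theorem smul_eq_of_mem_stabilizer_simplex {s : Finset P} (hs : IsChain (· ≤ ·) (s : Set P)) {g : G}
    (hg : g ∈ MulAction.stabilizer G (simplex s)) {p : P} (hp : p ∈ s) : g • p = p := by
  refine smul_eq_of_isChain hs (fun q hq => ?_) hp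
  have h1 : (vertex q).weight.support = {q} := Finsupp.support_single _ one_ne_zero
  have h2 : vertex q ∈ simplex s := by
    rw [mem_simplex, h1]
    exact Finset.singleton_subset_iff.2 hq
  have h3 : g • vertex q ∈ simplex s := by
    have := Set.smul_mem_smul_set (a := g) h2
    rwa [MulAction.mem_stabilizer_iff.1 hg] at this
  rw [mem_simplex, smul_support, h1] at h3
  exact h3 (by simp)

theorem isGCWComplex : IsGCWComplex G (cwComplex P) where
  hausdorff := inferInstance
  continuous_smul g := continuous_map _
  cellular g k σ := by
    let τ : Chains P k := ⟨σ.1.map (MulAction.toPerm g).toEmbedding, by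
      rw [Finset.coe_map]
      rintro _ ⟨a, ha, rfl⟩ _ ⟨b, hb, rfl⟩ _
      have hg : ∀ {p q : P}, p ≤ q → g • p ≤ g • q := fun h => CovariantClass.elim g h
      exact (σ.2.1.total ha hb).imp hg hg, by rw [Finset.card_map, σ.2.2]⟩
    refine ⟨τ, ?_⟩
    have h1 := openCell_cwComplex σ
    have h2 := openCell_cwComplex τ
    refine (congrArg (g • ·) h1).trans (Eq.trans ?_ h2.symm)
    ext x
    rw [Set.mem_smul_set]
    constructor
    · rintro ⟨y, hy, rfl⟩
      change (g • y).weight.support = _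
      rw [smul_support, show y.weight.support = σ.1 from hy]
    · intro hx
      refine ⟨g⁻¹ • x, ?_, smul_inv_smul g x⟩
      apply Finset.map_injective (MulAction.toPerm g).toEmbedding
      rw [← smul_support, smul_inv_smul]
      exact hx
  rigid k σ := by
    have h1 := openCell_cwComplex σ
    refine Eq.trans (congrArg _ h1) (Eq.trans ?_ (congrArg _ h1.symm))
    ext g
    rw [MulAction.mem_stabilizer_iff, mem_fixingSubgroup_iff]
    constructor
    · intro hg x hx
      have h2 : g • x ∈ {x : Realization P | x.weight.support = σ.1} :=
        hg ▸ Set.smul_mem_smul_set hx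
      refine smul_eq_self_of_forall fun p hp => ?_
      exact smul_eq_of_smul_mem_simplex σ.2.1 hx (Finset.Subset.antisymm_iff.1 h2).1
        ((show x.weight.support = σ.1 from hx) ▸ hp)
    · intro hg
      exact (Set.image_congr hg).trans (Set.image_id' _)

end action

end Realization

/-! ### Joins in Brown's poset and in its fixed posets. -/

namespace BrownMap

variable {n : ℕ}

theorem mul_apply (α β : BrownMap n) (s : Rays n) : (α * β) s = α (β s) := rfl

theorem shift_apply (y : Fin n) (s : Rays n) :
    shift y s = if s.2 = y then (s.1 + 1, s.2) else s := rfl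

theorem shift_pow_apply (y : Fin n) (k : ℕ) (s : Rays n) :
    (shift y ^ k) s = if s.2 = y then (s.1 + k, s.2) else s := by
  induction k with
  | zero =>
    split_ifs <;> rfl
  | succ k ih =>
    rw [pow_succ', mul_apply, ih, shift_apply]
    split_ifs <;> simp_all [add_assoc]

/-- Powers of the shifts prescribe the displacement of each ray independently, so with
`exists_of_mem_translations` the monoid of translations is identified with `Fin n → ℕ`. -/
theorem exists_translation_apply (k : Fin n → ℕ) :
    ∃ t ∈ translations n, ∀ s : Rays n, t s = (s.1 + k s.2, s.2) := by
  classical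
  have h : ∀ F : Finset (Fin n), ∃ t ∈ translations n, ∀ s : Rays n,
      t s = (s.1 + if s.2 ∈ F then k s.2 else 0, s.2) := by
    intro F
    induction F using Finset.induction_on with
    | empty => exact ⟨1, one_mem _, fun s => by simp; rfl⟩
    | insert y F hy ih =>
      obtain ⟨t, ht, e⟩ := ih
      refine ⟨shift y ^ k y * t,
        mul_mem (pow_mem (Submonoid.subset_closure (mem_range_self y)) _) ht,
        fun s => ?_⟩
      rw [mul_apply, e, shift_pow_apply]
      by_cases h : s.2 = y
      · simp [h, hy]
      · simp [h]
  obtain ⟨t, ht, e⟩ := h Finset.univ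
  exact ⟨t, ht, fun s => by simpa using e s⟩

theorem le_iff {α β : BrownMap n} :
    α ≤ β ↔ ∃ k : Fin n → ℕ, ∀ (i : ℕ) (x : Fin n), β (i, x) = α (i + k x, x) := by
  constructor
  · rintro ⟨t, ht, e⟩
    obtain ⟨k, hk⟩ := exists_of_mem_translations ht
    exact ⟨k, fun i x => by rw [e, hk]⟩
  · rintro ⟨k, hk⟩
    obtain ⟨t, ht, e⟩ := exists_translation_apply k
    exact ⟨t, ht, fun s => by rw [e, ← hk]⟩

/-- Any two elements agree on each ray up to translations of the source. -/
theorem exists_common_translate (α β : BrownMap n) (x : Fin n) :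
    ∃ k l : ℕ, ∀ i : ℕ, α (i + k, x) = β (i + l, x) := by
  obtain ⟨z, m, h⟩ := α.eventuallyTranslation
  obtain ⟨z', m', h'⟩ := β.eventuallyTranslation
  -- The second shift is `k + m x - m' x`, which makes the images agree. The absolute values in `k`
  -- keep it at least `z' x`, so both maps are already translations there.
  refine ⟨z x + z' x + (m x).natAbs + (m' x).natAbs,
    ((z x + z' x + (m x).natAbs + (m' x).natAbs : ℤ) + m x - m' x).toNat, fun i => ?_⟩
  obtain ⟨h1, h2⟩ := h x (i + (z x + z' x + (m x).natAbs + (m' x).natAbs)) (by omega)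
  obtain ⟨h3, h4⟩ := h' x
    (i + ((z x + z' x + (m x).natAbs + (m' x).natAbs : ℤ) + m x - m' x).toNat) (by omega)
  refine Prod.ext ?_ (h1.trans h3.symm)
  change (α.toFun _).1 = (β.toFun _).1
  omega

/-- Brown's poset is a join-semilattice. -/
theorem exists_isLUB (α β : BrownMap n) : ∃ γ, IsLUB {α, β} γ := by
  classical
  -- The join shifts `α` by the least admissible amount on each ray. An upper bound of `α` and `β`
  -- also exhibits an admissible shift of `α`, hence one at least as large.
  let k : Fin n → ℕ := fun x => Nat.find (exists_common_translate α β x)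
  have hk : ∀ x, ∃ l : ℕ, ∀ i : ℕ, α (i + k x, x) = β (i + l, x) := fun x =>
    Nat.find_spec (exists_common_translate α β x)
  choose l hl using hk
  obtain ⟨t, ht, e⟩ := exists_translation_apply k
  have hγ : ∀ (i : ℕ) (x : Fin n), (α * t) (i, x) = α (i + k x, x) := fun i x => by
    rw [mul_apply, e]
  refine ⟨α * t, ?_, ?_⟩
  · rintro _ (rfl | rfl)
    · exact le_iff.2 ⟨k, hγ⟩
    · exact le_iff.2 ⟨l, fun i x => by rw [hγ, hl]⟩
  · intro δ hδ
    obtain ⟨k', hk'⟩ := le_iff.1 (hδ (mem_insert α {β}))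
    obtain ⟨l', hl'⟩ := le_iff.1 (hδ (mem_insert_of_mem α (mem_singleton β)))
    have hle : ∀ x, k x ≤ k' x := fun x =>
      Nat.find_min' _ ⟨l' x, fun i => by rw [← hk', hl']⟩
    refine le_iff.2 ⟨fun x => k' x - k x, fun i x => ?_⟩
    rw [hγ, hk', add_assoc, Nat.sub_add_cancel (hle x)]

/-- The join of two elements. -/
noncomputable def join (α β : BrownMap n) : BrownMap n := (exists_isLUB α β).choose

theorem isLUB_join (α β : BrownMap n) : IsLUB {α, β} (join α β) := (exists_isLUB α β).choose_spec

theorem le_join_left (α β : BrownMap n) : α ≤ join α β := (isLUB_join α β).1 (by simp)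

theorem le_join_right (α β : BrownMap n) : β ≤ join α β := (isLUB_join α β).1 (by simp)

/-- The monotone map that joins with a fixed element. -/
noncomputable def joinHom (a : BrownMap n) : BrownMap n →o BrownMap n where
  toFun α := join α a
  monotone' α β h := (isLUB_join α a).2 (by
    rintro _ (rfl | rfl)
    · exact h.trans (le_join_left β a)
    · exact le_join_right β _)

/-- The group composes on the left and the order on the right. Consequently the join of a fixed
element with any other element is fixed. -/
theorem isUpperSet_fixedPoints (Q : Subgroup (HoughtonGroup n)) :
    IsUpperSet (MulAction.fixedPoints Q (BrownMap n)) := by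
  rintro α β ⟨t, -, e⟩ hα q
  refine DFunLike.ext _ _ fun s => ?_
  change q.1.1 (β s) = β s
  rw [e]
  exact DFunLike.congr_fun (hα q) (t s)

theorem directedOn_fixedPoints (Q : Subgroup (HoughtonGroup n)) :
    DirectedOn (· ≤ ·) (MulAction.fixedPoints Q (BrownMap n)) := fun α hα β _ =>
  ⟨join α β, isUpperSet_fixedPoints Q (le_join_left α β) hα, le_join_left α β, le_join_right α β⟩

/-! ### Finite stabilisers and fixed points of finite subgroups. -/

theorem finite_compl_range (α : BrownMap n) : (range α)ᶜ.Finite := by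
  obtain ⟨z, m, h⟩ := α.eventuallyTranslation
  refine (((finite_Iio (∑ x, (z x + (m x).natAbs))).prod finite_univ)).subset ?_
  rintro ⟨i, x⟩ hs
  refine ⟨?_, mem_univ _⟩
  by_contra hi
  have hle : z x + (m x).natAbs ≤ ∑ x, (z x + (m x).natAbs) :=
    Finset.single_le_sum (f := fun x => z x + (m x).natAbs) (fun _ _ => Nat.zero_le _)
      (Finset.mem_univ x)
  have hi' : ∑ x, (z x + (m x).natAbs) ≤ i := not_lt.1 hi
  obtain ⟨h1, h2⟩ := h x ((i : ℤ) - m x).toNat (by omega)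
  refine hs ⟨(((i : ℤ) - m x).toNat, x), Prod.ext ?_ h1⟩
  change (α.toFun _).1 = i
  omega

/-- Stabilisers of elements of Brown's poset are finite. -/
theorem finite_stabilizer (α : BrownMap n) :
    Finite (MulAction.stabilizer (HoughtonGroup n) α) := by
  classical
  -- Fixing `α` means being the identity on its range, so the stabiliser embeds in the permutations
  -- of the finite complement.
  have : Finite {s // s ∈ (range α)ᶜ} := (finite_compl_range α).to_subtype
  have : Finite {f : Equiv.Perm (Rays n) // ∀ s, ¬ s ∈ (range α)ᶜ → f s = s} :=
    Finite.of_equiv _ (Equiv.Perm.subtypeEquivSubtypePerm (· ∈ (range α)ᶜ))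
  refine Finite.of_injective
    (β := {f : Equiv.Perm (Rays n) // ∀ s, ¬ s ∈ (range α)ᶜ → f s = s})
    (fun h => ⟨h.1.1, fun s hs => ?_⟩) fun h h' e => ?_
  · obtain ⟨r, rfl⟩ := not_not.1 hs
    exact DFunLike.congr_fun (MulAction.mem_stabilizer_iff.1 h.2) r
  · exact Subtype.ext (Subtype.ext (congrArg (fun f => f.1) e))

theorem finite_of_forall_smul_eq {Q : Subgroup (HoughtonGroup n)} {α : BrownMap n}
    (h : ∀ g ∈ Q, g • α = α) : Finite Q := by
  have := finite_stabilizer α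
  exact Finite.Set.subset (MulAction.stabilizer (HoughtonGroup n) α : Set (HoughtonGroup n)) h

/-- An element of finite order of Houghton's group is eventually the identity. -/
theorem exists_forall_apply_eq {h : HoughtonGroup n} (hf : IsOfFinOrder h) :
    ∃ z : ℕ, ∀ (i : ℕ) (x : Fin n), z ≤ i → h.1 (i, x) = (i, x) := by
  -- With positive translation length, the orbit of `(z, x)` moves outwards forever and never
  -- returns.
  have key : ∀ {h : HoughtonGroup n}, IsOfFinOrder h → ∀ {x : Fin n} {z : ℕ} {m : ℤ},
      (∀ i : ℕ, z ≤ i → (h.1 (i, x)).2 = x ∧ ((h.1 (i, x)).1 : ℤ) = i + m) → m ≤ 0 := by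
    intro h hf x z m hz
    by_contra! hm
    have hpow : ∀ k : ℕ, ((h ^ k).1 (z, x)).2 = x ∧ (((h ^ k).1 (z, x)).1 : ℤ) = z + k * m := by
      intro k
      induction k with
      | zero => simp
      | succ k ih =>
        have e : (h ^ (k + 1)).1 (z, x) = h.1 ((h ^ k).1 (z, x)) := by
          rw [pow_succ']
          rfl
        have e' : (h ^ k).1 (z, x) = (((h ^ k).1 (z, x)).1, x) := Prod.ext rfl ih.1
        have hk : (0 : ℤ) ≤ k * m := by positivity
        obtain ⟨h1, h2⟩ := hz ((h ^ k).1 (z, x)).1 (by omega)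
        rw [← e', ← e] at h1 h2
        refine ⟨h1, ?_⟩
        rw [h2, ih.2]
        push_cast
        ring
    obtain ⟨k, hk, e⟩ := isOfFinOrder_iff_pow_eq_one.1 hf
    have h1 := (hpow k).2
    rw [e] at h1
    have h2 : (0 : ℤ) < k * m := by positivity
    have h3 : (((1 : HoughtonGroup n).1 (z, x)).1 : ℤ) = z := rfl
    omega
  obtain ⟨z, m, hz⟩ := h.2
  obtain ⟨z', m', hz'⟩ := (h⁻¹).2
  have hm : ∀ x, m x = 0 := by
    intro x
    -- The inverse translates by `-m x` on this ray, as seen at a point far enough out, so `key` for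
    -- both elements forces length zero.
    have h1 := key hf (hz x)
    have h2 := key hf.inv (hz' x)
    obtain ⟨h3, h4⟩ := hz x (z x + z' x + (m x).natAbs) (by omega)
    have e : h.1 (z x + z' x + (m x).natAbs, x) =
      ((h.1 (z x + z' x + (m x).natAbs, x)).1, x) := Prod.ext rfl h3
    obtain ⟨-, h6⟩ := hz' x (h.1 (z x + z' x + (m x).natAbs, x)).1 (by omega)
    rw [← e] at h6
    have h7 : (h⁻¹).1 (h.1 (z x + z' x + (m x).natAbs, x)) =
      (z x + z' x + (m x).natAbs, x) := h.1.symm_apply_apply _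
    rw [h7] at h6
    simp only at h6
    omega
  refine ⟨∑ x, z x, fun i x hi => ?_⟩
  have hle : z x ≤ ∑ x, z x :=
    Finset.single_le_sum (fun _ _ => Nat.zero_le _) (Finset.mem_univ x)
  obtain ⟨h1, h2⟩ := hz x i (hle.trans hi)
  rw [hm, add_zero] at h2
  exact Prod.ext (by exact_mod_cast h2) h1

/-- A translation by the sum of the thresholds of all elements of `Q` has its image where each of
them is the identity. -/
theorem nonempty_fixedPoints (Q : Subgroup (HoughtonGroup n)) [Finite Q] :
    (MulAction.fixedPoints Q (BrownMap n)).Nonempty := by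
  have hQ : ∀ q : Q, ∃ z : ℕ, ∀ (i : ℕ) (x : Fin n), z ≤ i → q.1.1 (i, x) = (i, x) := fun q =>
    exists_forall_apply_eq (Q.subtype.isOfFinOrder (isOfFinOrder_of_finite q))
  choose z hz using hQ
  have := Fintype.ofFinite Q
  obtain ⟨t, -, e⟩ := exists_translation_apply (n := n) fun _ => ∑ q, z q
  refine ⟨t, fun q => DFunLike.ext _ _ fun s => ?_⟩
  change q.1.1 (t s) = t s
  rw [e]
  exact hz q _ _ ((Finset.single_le_sum (fun _ _ => Nat.zero_le _) (Finset.mem_univ q)).trans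
    (Nat.le_add_left _ _))

/-- Joining with one fixed element `a` is the cone map; it preserves the fixed poset because that is
an upper set. -/
theorem contractibleSpace_fixedPoints (Q : Subgroup (HoughtonGroup n)) [Finite Q] :
    ContractibleSpace (MulAction.fixedPoints Q (Realization (BrownMap n))) := by
  obtain ⟨a, ha⟩ := nonempty_fixedPoints Q
  rw [Realization.fixedPoints_eq_supportedIn]
  exact Realization.contractibleSpace_supportedIn ha (joinHom a)
    (fun α hα => isUpperSet_fixedPoints Q (le_join_left α a) hα)
    (fun α => le_join_left α a) fun α => le_join_right α a

theorem fixedPoints_realization_eq_empty (Q : Subgroup (HoughtonGroup n)) (hQ : ¬ Finite Q) :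
    MulAction.fixedPoints Q (Realization (BrownMap n)) = ∅ := by
  rw [Realization.fixedPoints_eq_supportedIn]
  refine eq_empty_of_forall_notMem fun x hx => hQ ?_
  obtain ⟨α, hα⟩ := x.support_nonempty
  exact finite_of_forall_smul_eq fun g hg => hx hα ⟨g, hg⟩

end BrownMap

theorem mainTheorem5 (n : ℕ) (hn : 1 < n) :
    -- `|M|`, with its simplices as cells, is a model for the classifying space for proper actions
    (∃ cw : CWComplex (univ : Set (Realization (BrownMap n))),
      (∀ k : ℕ,
        Set.range (RelCWComplex.closedCell (C := (univ : Set (Realization (BrownMap n)))) k) =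
          {A | ∃ s : Finset (BrownMap n), IsChain (· ≤ ·) (s : Set (BrownMap n)) ∧
            s.card = k + 1 ∧ A = Realization.simplex s}) ∧
      IsModelForE (HoughtonGroup n) (finiteSubgroups (HoughtonGroup n)) cw) ∧
    -- stabilisers of simplices are finite
    (∀ s : Finset (BrownMap n), s.Nonempty → IsChain (· ≤ ·) (s : Set (BrownMap n)) →
      Finite (MulAction.stabilizer (HoughtonGroup n) (Realization.simplex s))) ∧
    -- fixed sets of finite subgroups are non-empty and contractible, and fixed posets directed
    (∀ Q : Subgroup (HoughtonGroup n), Finite Q →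
      (MulAction.fixedPoints Q (BrownMap n)).Nonempty ∧
      DirectedOn (· ≤ ·) (MulAction.fixedPoints Q (BrownMap n)) ∧
      (MulAction.fixedPoints Q (Realization (BrownMap n))).Nonempty ∧
      ContractibleSpace (MulAction.fixedPoints Q (Realization (BrownMap n)))) ∧
    -- fixed sets of infinite subgroups are empty
    (∀ Q : Subgroup (HoughtonGroup n), Infinite Q →
      MulAction.fixedPoints Q (Realization (BrownMap n)) = ∅) := by
  refine ⟨⟨Realization.cwComplex _, Realization.range_closedCell_cwComplex, ?_⟩, ?_, ?_, ?_⟩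
  · exact
      { toIsGCWComplex := Realization.isGCWComplex
        contractible := fun Q hQ =>
          have : Finite Q := hQ
          BrownMap.contractibleSpace_fixedPoints Q
        empty := fun Q hQ => BrownMap.fixedPoints_realization_eq_empty Q hQ }
  · rintro s ⟨α, hα⟩ hs
    -- The stabiliser of the simplex lies in that of any one of its vertices.
    have := BrownMap.finite_stabilizer α
    exact Finite.Set.subset (MulAction.stabilizer (HoughtonGroup n) α : Set (HoughtonGroup n))
      fun g hg => Realization.smul_eq_of_mem_stabilizer_simplex hs hg hα
  · intro Q hQ
    have h := BrownMap.contractibleSpace_fixedPoints Q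
    exact ⟨BrownMap.nonempty_fixedPoints Q, BrownMap.directedOn_fixedPoints Q,
      nonempty_coe_sort.1 inferInstance, h⟩
  · exact fun Q hQ => BrownMap.fixedPoints_realization_eq_empty Q (not_finite_iff_infinite.2 hQ)
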